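/- Let $\Gamma$ be a finitely generated discrete group with a finite symmetric generating set $Q$ and word length $l$. Let $\mathrm{Sub}(\Gamma)$ be the space of subgroups of $\Gamma$ with the topology of pointwise convergence of characteristic functions, on which $\Gamma$ acts by $\gamma.H=\gamma H\gamma^{-1}$. Let $Z\subseteq \mathrm{Sub}(\Gamma)$ be a uniformly recurrent subgroup, i.e. a nonempty, closed, $\Gamma$-invariant subset in which every orbit is dense. For $H\in Z$ let $S=S_\Gamma^Q(H)$ be the Schreier graph with vertex set $\Gamma/H$ and an edge labelled $q$ from $x$ to $qx$ for all $x\in\Gamma/H$, $q\in Q$; let $d$ be its shortest-path metric. A *local kernel* is a function $K:\Gamma/H\times\Gamma/H\to\mathbb{C}$ for which there is $R\in\mathbb{N}$ such that $K(x,y)=0$ whenever $d(x,y)>R$, and $K(x,\gamma x)=K(y,\gamma y)$ whenever $l(\gamma)\le R$ and the balls $B_R(S,x)$ and $B_R(S,y)$ are isomorphic by a root- and label-preserving isomorphism. The local kernels form a $*$-algebra $\mathbb{C}Z$ with pointwise linear operations, product $(KL)(x,y)=\sum_z K(x,z)L(z,y)$ and involution $K^*(x,y)=\overline{K(y,x)}$,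 represented by bounded operators on $\ell^2(\Gamma/H)$ by $(Kf)(x)=\sum_y K(x,y)f(y)$. Let $C^*_r(Z)$ be the completion of $\mathbb{C}Z$ in the norm induced by this representation. If $Z$ is generic, that is, if for every $H\in Z$ the stabiliser $\{\gamma\in\Gamma:\gamma H\gamma^{-1}=H\}$ equals $H$, then (for any choice of $Q$ and of $H\in Z$) the $C^*$-algebra $C^*_r(Z)$ is simple: it is nonzero and its only closed two-sided ideals are $0$ and itself. -/

import Mathlib

open scoped Pointwise ENNReal

noncomputable section

namespace Elek

section Subgroups

variable {Γ : Type*} [Group Γ]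

open scoped Classical in
/-- The space `Sub(Γ)` of subgroups of a discrete group, with the topology of pointwise convergence
of characteristic functions (with values in the discrete two-point space `Bool`). -/
instance subgroupTopology : TopologicalSpace (Subgroup Γ) :=
  TopologicalSpace.induced (fun (H : Subgroup Γ) (γ : Γ) => decide (γ ∈ H)) inferInstance

/-- The conjugation action of `Γ` on `Sub(Γ)`: `γ.H = γ H γ⁻¹`. -/
def conj (γ : Γ) (H : Subgroup Γ) : Subgroup Γ := H.map (MulAut.conj γ).toMonoidHom

/-- A uniformly recurrent subgroup (URS): a nonempty, closed, conjugation-invariant subset of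
`Sub(Γ)` in which every orbit is dense. -/
structure IsURS (Z : Set (Subgroup Γ)) : Prop where
  nonempty : Z.Nonempty
  isClosed : IsClosed Z
  conj_mem : ∀ γ : Γ, ∀ H ∈ Z, conj γ H ∈ Z
  minimal : ∀ H ∈ Z, Z ⊆ closure (Set.range fun γ : Γ => conj γ H)

/-- `Z` is generic if the stabiliser (for the conjugation action) of every `H ∈ Z` is `H`. -/
def IsGeneric (Z : Set (Subgroup Γ)) : Prop :=
  ∀ H ∈ Z, {γ : Γ | conj γ H = H} = (H : Set Γ)

end Subgroups

/-- A finite symmetric system of generators of a group. -/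
structure GeneratingSystem (Γ : Type*) [Group Γ] where
  gens : Finset Γ
  inv_mem : ∀ q ∈ gens, q⁻¹ ∈ gens
  closure_eq_top : Subgroup.closure (gens : Set Γ) = ⊤

section Schreier

variable {Γ : Type*} [Group Γ] (Q : GeneratingSystem Γ) (H : Subgroup Γ)

/-- The length `l(γ)` of `γ` as a word in the generators. -/
def wordLength (γ : Γ) : ℕ :=
  sInf {n | ∃ l : List Γ, l.length = n ∧ (∀ q ∈ l, q ∈ Q.gens) ∧ l.prod = γ}

/-- The labelled edges of the Schreier graph on `Γ/H`: there is an edge labelled `q`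
from `u` to `v` iff `q` is one of the generators and `v = q u`. -/
def SchreierEdge (q : Γ) (u v : Γ ⧸ H) : Prop := q ∈ Q.gens ∧ q • u = v

/-- The simple graph underlying the Schreier graph (labels, orientations, loops and multiplicities
are forgotten); it has the same shortest-path metric. -/
def schreierGraph : SimpleGraph (Γ ⧸ H) where
  Adj u v := u ≠ v ∧ ∃ q, SchreierEdge Q H q u v
  symm := ⟨by
    rintro u v ⟨hne, q, hq, rfl⟩
    exact ⟨hne.symm, q⁻¹, Q.inv_mem q hq, by simp⟩⟩
  loopless := ⟨fun u h => h.1 rfl⟩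

/-- The shortest-path metric of the Schreier graph (which is connected). -/
def schreierDist (x y : Γ ⧸ H) : ℕ := (schreierGraph Q H).dist x y

/-- The ball `B_R(x)` in the Schreier graph. -/
def schreierBall (R : ℕ) (x : Γ ⧸ H) : Set (Γ ⧸ H) := {y | schreierDist Q H x y ≤ R}

/-- The balls `B_R(x)` and `B_R(y)`, as full subgraphs of the Schreier graph, are root-label
isomorphic: there is a bijection that maps `x` to `y` and respects the labelled edges. -/
def RootLabelIso (R : ℕ) (x y : Γ ⧸ H) : Prop :=
  ∃ θ : schreierBall Q H R x ≃ schreierBall Q H R y,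
    (∀ u : schreierBall Q H R x, (u : Γ ⧸ H) = x → (θ u : Γ ⧸ H) = y) ∧
    ∀ (q : Γ) (u v : schreierBall Q H R x),
      SchreierEdge Q H q (u : Γ ⧸ H) v ↔ SchreierEdge Q H q (θ u : Γ ⧸ H) (θ v)

/-- `K` is a local kernel of width `R` on the Schreier graph of `H`. -/
structure IsLocalKernelOfWidth (R : ℕ) (K : Γ ⧸ H → Γ ⧸ H → ℂ) : Prop where
  eq_zero : ∀ x y, R < schreierDist Q H x y → K x y = 0
  local_eq : ∀ x y, RootLabelIso Q H R x y →
    ∀ γ : Γ, wordLength Q γ ≤ R → K x (γ • x) = K y (γ • y)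

/-- `K` is a local kernel (of some finite width). -/
def IsLocalKernel (K : Γ ⧸ H → Γ ⧸ H → ℂ) : Prop := ∃ R, IsLocalKernelOfWidth Q H R K

/-! ### Word length and distances -/

variable {Q H}

theorem wordLength_le_iff {γ : Γ} {n : ℕ} : wordLength Q γ ≤ n ↔
    ∃ l : List Γ, l.length ≤ n ∧ (∀ q ∈ l, q ∈ Q.gens) ∧ l.prod = γ := by
  constructor
  · intro h
    have hne : {n | ∃ l : List Γ, l.length = n ∧ (∀ q ∈ l, q ∈ Q.gens) ∧ l.prod = γ}.Nonempty := by
      have hγ : γ ∈ (Subgroup.closure (Q.gens : Set Γ)).toSubmonoid := by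
        rw [Q.closure_eq_top]; trivial
      rw [Subgroup.closure_toSubmonoid] at hγ
      obtain ⟨l, hl, rfl⟩ := Submonoid.exists_list_of_mem_closure hγ
      refine ⟨_, l, rfl, fun q hq => ?_, rfl⟩
      rcases hl q hq with h | h
      · exact h
      · simpa using Q.inv_mem _ h
    obtain ⟨l, h1, h2, h3⟩ := Nat.sInf_mem hne
    exact ⟨l, h1.le.trans h, h2, h3⟩
  · rintro ⟨l, h1, h2, h3⟩
    have hmem : l.length ∈ {n | ∃ l : List Γ, l.length = n ∧ (∀ q ∈ l, q ∈ Q.gens) ∧ l.prod = γ} :=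
      ⟨l, rfl, h2, h3⟩
    exact (Nat.sInf_le hmem).trans h1

theorem wordLength_one_le (n : ℕ) : wordLength Q (1 : Γ) ≤ n :=
  wordLength_le_iff.2 ⟨[], by simp, by simp, by simp⟩

theorem wordLength_mul_le {a b : Γ} {m n : ℕ} (ha : wordLength Q a ≤ m)
    (hb : wordLength Q b ≤ n) : wordLength Q (a * b) ≤ m + n := by
  obtain ⟨l, h1, h2, rfl⟩ := wordLength_le_iff.1 ha
  obtain ⟨l', h1', h2', rfl⟩ := wordLength_le_iff.1 hb
  refine wordLength_le_iff.2 ⟨l ++ l', by simp; omega, fun q hq => ?_, by simp⟩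
  rcases List.mem_append.1 hq with h | h
  exacts [h2 q h, h2' q h]

theorem wordLength_inv_le {a : Γ} {m : ℕ} (ha : wordLength Q a ≤ m) :
    wordLength Q a⁻¹ ≤ m := by
  obtain ⟨l, h1, h2, rfl⟩ := wordLength_le_iff.1 ha
  refine wordLength_le_iff.2 ⟨(l.map fun x => x⁻¹).reverse, by simpa using h1, fun q hq => ?_,
    (List.prod_inv_reverse l).symm⟩
  simp only [List.mem_reverse, List.mem_map] at hq
  obtain ⟨a, ha, rfl⟩ := hq
  exact Q.inv_mem a (h2 a ha)

theorem wordLength_gen_le {q : Γ} (hq : q ∈ Q.gens) : wordLength Q q ≤ 1 :=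
  wordLength_le_iff.2 ⟨[q], by simp, by simpa using hq, by simp⟩

theorem finite_wordBall (Q : GeneratingSystem Γ) (n : ℕ) : {γ : Γ | wordLength Q γ ≤ n}.Finite := by
  refine ((List.finite_length_le Q.gens n).image
    fun l => (l.map (Subtype.val : Q.gens → Γ)).prod).subset ?_
  intro γ hγ
  obtain ⟨l, h1, h2, rfl⟩ := wordLength_le_iff.1 hγ
  lift l to List Q.gens using h2
  exact ⟨l, by simpa using h1, rfl⟩

theorem exists_walk (l : List Γ) (hl : ∀ q ∈ l, q ∈ Q.gens) (x y : Γ ⧸ H)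
    (hy : l.prod • x = y) : ∃ p : (schreierGraph Q H).Walk x y, p.length ≤ l.length := by
  induction l generalizing y with
  | nil =>
    obtain rfl : x = y := by simpa using hy
    exact ⟨.nil, by simp⟩
  | cons q l ih =>
    obtain ⟨p, hp⟩ := ih (fun a ha => hl a (List.mem_cons_of_mem _ ha)) _ rfl
    have hq : q ∈ Q.gens := hl q (by simp)
    rw [List.prod_cons, mul_smul] at hy
    by_cases h : l.prod • x = y
    · subst h
      exact ⟨p, hp.trans (by simp)⟩
    · have hadj : (schreierGraph Q H).Adj (l.prod • x) y := ⟨h, q, hq, hy⟩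
      exact ⟨p.concat hadj, by rw [SimpleGraph.Walk.length_concat, List.length_cons]; omega⟩

theorem walk_exists {x y : Γ ⧸ H} (p : (schreierGraph Q H).Walk x y) :
    ∃ γ : Γ, wordLength Q γ ≤ p.length ∧ γ • x = y := by
  induction p with
  | nil => exact ⟨1, wordLength_one_le _, one_smul _ _⟩
  | cons h p ih =>
    obtain ⟨-, q, hq, rfl⟩ := h
    obtain ⟨γ, h1, h2⟩ := ih
    exact ⟨γ * q, wordLength_mul_le h1 (wordLength_gen_le hq),
      by rw [mul_smul, h2]⟩

theorem schreierDist_le_iff {x y : Γ ⧸ H} {n : ℕ} : schreierDist Q H x y ≤ n ↔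
    ∃ γ : Γ, wordLength Q γ ≤ n ∧ γ • x = y := by
  constructor
  · intro h
    have hreach : (schreierGraph Q H).Reachable x y := by
      obtain ⟨γ, rfl⟩ := MulAction.exists_smul_eq Γ x y
      obtain ⟨l, -, hl, rfl⟩ := wordLength_le_iff.1 (le_refl (wordLength Q γ))
      exact ⟨(exists_walk l hl x _ rfl).choose⟩
    obtain ⟨p, hp⟩ := hreach.exists_walk_length_eq_dist
    obtain ⟨γ, h1, h2⟩ := walk_exists p
    exact ⟨γ, h1.trans (hp.le.trans h), h2⟩
  · rintro ⟨γ, h, rfl⟩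
    obtain ⟨l, h1, hl, rfl⟩ := wordLength_le_iff.1 h
    obtain ⟨p, hp⟩ := exists_walk l hl x _ rfl
    exact (SimpleGraph.dist_le p).trans (hp.trans h1)

/-! ### Root-label isomorphic balls in terms of group elements -/

/-- The elements of `P` that fix `x` are those that fix `y`. -/
def SamePattern (P : Set Γ) (x y : Γ ⧸ H) : Prop := ∀ g ∈ P, g • x = x ↔ g • y = y

theorem RootLabelIso.smul_eq {R : ℕ} {x y : Γ ⧸ H}
    {θ : schreierBall Q H R x ≃ schreierBall Q H R y}
    (hroot : ∀ u : schreierBall Q H R x, (u : Γ ⧸ H) = x → (θ u : Γ ⧸ H) = y)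
    (hedge : ∀ (q : Γ) (u v : schreierBall Q H R x), SchreierEdge Q H q (u : Γ ⧸ H) v ↔
      SchreierEdge Q H q (θ u : Γ ⧸ H) (θ v)) {g : Γ}
    (hg : wordLength Q g ≤ R) (u : schreierBall Q H R x) (hu : (u : Γ ⧸ H) = g • x) :
    (θ u : Γ ⧸ H) = g • y := by
  obtain ⟨l, h1, hl, rfl⟩ := wordLength_le_iff.1 hg
  clear hg
  induction l generalizing u with
  | nil => simpa using hroot u (by simpa using hu)
  | cons q l ih =>
    have hl' : ∀ a ∈ l, a ∈ Q.gens := fun a ha => hl a (List.mem_cons_of_mem _ ha)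
    have hlen : l.length ≤ R := by simp at h1; omega
    have hv : l.prod • x ∈ schreierBall Q H R x :=
      schreierDist_le_iff.2 ⟨l.prod, wordLength_le_iff.2 ⟨l, hlen, hl', rfl⟩, rfl⟩
    have h := ih ⟨_, hv⟩ hlen hl' rfl
    have he : SchreierEdge Q H q (l.prod • x) u :=
      ⟨hl q (by simp), by rw [hu, List.prod_cons, mul_smul]⟩
    have := ((hedge q ⟨_, hv⟩ u).1 he).2
    rw [← this, h, List.prod_cons, mul_smul]

theorem RootLabelIso.symm {R : ℕ} {x y : Γ ⧸ H} (h : RootLabelIso Q H R x y) :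
    RootLabelIso Q H R y x := by
  obtain ⟨θ, h1, h2⟩ := h
  refine ⟨θ.symm, fun u hu => ?_, fun q u v => ?_⟩
  · have hx : x ∈ schreierBall Q H R x :=
      schreierDist_le_iff.2 ⟨1, wordLength_one_le _, one_smul _ _⟩
    have : θ ⟨x, hx⟩ = u := Subtype.ext ((h1 _ rfl).trans hu.symm)
    rw [← this]; simp
  · rw [h2]; simp

theorem RootLabelIso.smul_eq_smul {R : ℕ} {x y : Γ ⧸ H} (h : RootLabelIso Q H R x y) {g g' : Γ}
    (hg : wordLength Q g ≤ R) (hg' : wordLength Q g' ≤ R) (he : g • x = g' • x) :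
    g • y = g' • y := by
  obtain ⟨θ, h1, h2⟩ := h
  have hu : g • x ∈ schreierBall Q H R x := schreierDist_le_iff.2 ⟨g, hg, rfl⟩
  rw [← RootLabelIso.smul_eq h1 h2 hg ⟨_, hu⟩ rfl, ← RootLabelIso.smul_eq h1 h2 hg' ⟨_, hu⟩ he]

theorem rootLabelIso_of_samePattern {R : ℕ} {x y : Γ ⧸ H}
    (h : SamePattern {g | wordLength Q g ≤ 2 * R + 1} x y) : RootLabelIso Q H R x y := by
  have key : ∀ a b : Γ, wordLength Q (b⁻¹ * a) ≤ 2 * R + 1 → (a • x = b • x ↔ a • y = b • y) := by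
    intro a b hab
    have := h _ hab
    rwa [mul_smul, mul_smul, inv_smul_eq_iff, inv_smul_eq_iff] at this
  have key2 : ∀ a b : Γ, wordLength Q a ≤ R → wordLength Q b ≤ R →
      (a • x = b • x ↔ a • y = b • y) := fun a b ha hb =>
    key a b ((wordLength_mul_le (wordLength_inv_le hb) ha).trans (by omega))
  have hx : ∀ u : schreierBall Q H R x, ∃ γ : Γ, wordLength Q γ ≤ R ∧ γ • x = u :=
    fun u => schreierDist_le_iff.1 u.2
  have hy : ∀ u : schreierBall Q H R y, ∃ γ : Γ, wordLength Q γ ≤ R ∧ γ • y = u :=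
    fun u => schreierDist_le_iff.1 u.2
  choose a ha ha' using hx
  choose b hb hb' using hy
  let θ : schreierBall Q H R x ≃ schreierBall Q H R y :=
    { toFun := fun u => ⟨a u • y, schreierDist_le_iff.2 ⟨_, ha u, rfl⟩⟩
      invFun := fun u => ⟨b u • x, schreierDist_le_iff.2 ⟨_, hb u, rfl⟩⟩
      left_inv := fun u => Subtype.ext <| by
        rw [← ha' u]
        exact (key2 _ _ (hb _) (ha _)).2 (hb' _)
      right_inv := fun u => Subtype.ext <| by
        conv_rhs => rw [← hb' u]
        exact (key2 _ _ (ha _) (hb _)).1 (ha' _) }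
  refine ⟨θ, fun u hu => ?_, fun q u v => ?_⟩
  · have := (key2 (a u) 1 (ha u) (wordLength_one_le _)).1 (by rw [ha', hu, one_smul])
    exact this.trans (one_smul _ _)
  · refine and_congr_right fun hq => ?_
    change q • (u : Γ ⧸ H) = v ↔ q • (a u • y) = a v • y
    rw [← ha' u, ← ha' v, ← mul_smul, ← mul_smul]
    refine key _ _ ?_
    refine (wordLength_mul_le (wordLength_inv_le (ha v))
      (wordLength_mul_le (wordLength_gen_le hq) (ha u))).trans (by omega)

/-- A length-free description of local kernels. -/
theorem isLocalKernel_iff {K : Γ ⧸ H → Γ ⧸ H → ℂ} : IsLocalKernel Q H K ↔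
    (∃ F : Finset Γ, ∀ x y, K x y ≠ 0 → ∃ g ∈ F, g • x = y) ∧
    ∀ g : Γ, ∃ P : Finset Γ, ∀ x y, SamePattern (P : Set Γ) x y →
      K x (g • x) = K y (g • y) := by
  classical
  constructor
  · rintro ⟨R, hK⟩
    have hsupp : ∀ x y, K x y ≠ 0 → ∃ g ∈ (finite_wordBall Q R).toFinset, g • x = y := by
      intro x y hxy
      obtain ⟨g, hg, hgx⟩ := schreierDist_le_iff.1 (not_lt.1 fun h => hxy (hK.eq_zero x y h))
      exact ⟨g, by simpa using hg, hgx⟩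
    refine ⟨⟨_, hsupp⟩, fun g => ?_⟩
    refine ⟨(finite_wordBall Q (2 * R + 1)).toFinset ∪
      ((finite_wordBall Q R).toFinset.image fun h => h⁻¹ * g), fun x y hxy => ?_⟩
    have hiso : RootLabelIso Q H R x y :=
      rootLabelIso_of_samePattern fun a ha => hxy a (by simp at ha ⊢; exact Or.inl ha)
    have hpat : ∀ h, wordLength Q h ≤ R → (g • x = h • x ↔ g • y = h • y) := by
      intro h hh
      have := hxy (h⁻¹ * g) (by simp; exact Or.inr hh)
      rwa [mul_smul, mul_smul, inv_smul_eq_iff, inv_smul_eq_iff] at this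
    by_cases hex : ∃ h, wordLength Q h ≤ R ∧ g • x = h • x
    · obtain ⟨h, hh, hgh⟩ := hex
      rw [(hpat h hh).1 hgh, hgh]
      exact hK.local_eq x y hiso h hh
    · have h1 : K x (g • x) = 0 := by
        by_contra hne
        obtain ⟨h, hh, he⟩ := hsupp _ _ hne
        exact hex ⟨h, by simpa using hh, he.symm⟩
      have h2 : K y (g • y) = 0 := by
        by_contra hne
        obtain ⟨h, hh, he⟩ := hsupp _ _ hne
        have hh : wordLength Q h ≤ R := by simpa using hh
        exact hex ⟨h, hh, (hpat h hh).2 he.symm⟩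
      rw [h1, h2]
  · rintro ⟨⟨F, hF⟩, hloc⟩
    choose P hP using hloc
    let S : Finset Γ := F ∪ F.biUnion P
    let R : ℕ := S.sup (wordLength Q)
    have hR : ∀ g ∈ S, wordLength Q g ≤ R := fun g hg => Finset.le_sup hg
    have hRF : ∀ g ∈ F, wordLength Q g ≤ R := fun g hg => hR g (Finset.mem_union_left _ hg)
    refine ⟨R, fun x y hxy => ?_, fun x y hiso γ hγ => ?_⟩
    · by_contra hne
      obtain ⟨g, hg, he⟩ := hF x y hne
      exact absurd (schreierDist_le_iff.2 ⟨g, hRF g hg, he⟩) (not_le.2 hxy)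
    · by_cases hex : ∃ h ∈ F, γ • x = h • x
      · obtain ⟨h, hh, he⟩ := hex
        rw [hiso.smul_eq_smul hγ (hRF h hh) he, he]
        refine hP h x y fun g hg => ?_
        have hgR : wordLength Q g ≤ R :=
          hR g (Finset.mem_union_right _ (Finset.mem_biUnion.2 ⟨h, hh, hg⟩))
        constructor
        · intro h'
          simpa using hiso.smul_eq_smul hgR (wordLength_one_le _) (h'.trans (one_smul _ x).symm)
        · intro h'
          simpa using hiso.symm.smul_eq_smul hgR (wordLength_one_le _)
            (h'.trans (one_smul _ y).symm)
      · have h1 : K x (γ • x) = 0 := by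
          by_contra hne
          obtain ⟨h, hh, he⟩ := hF _ _ hne
          exact hex ⟨h, hh, he.symm⟩
        have h2 : K y (γ • y) = 0 := by
          by_contra hne
          obtain ⟨h, hh, he⟩ := hF _ _ hne
          exact hex ⟨h, hh, hiso.symm.smul_eq_smul hγ (hRF h hh) he.symm⟩
        rw [h1, h2]

variable (Q H)

/-- The local kernels form a vector space under pointwise operations. -/
def localKernels : Submodule ℂ (Γ ⧸ H → Γ ⧸ H → ℂ) where
  carrier := {K | IsLocalKernel Q H K}
  zero_mem' := isLocalKernel_iff.2 ⟨⟨∅, by simp⟩, fun _ => ⟨∅, by simp⟩⟩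
  add_mem' := by
    classical
    intro K L hK hL
    obtain ⟨⟨F, hF⟩, hK⟩ := isLocalKernel_iff.1 hK
    obtain ⟨⟨G, hG⟩, hL⟩ := isLocalKernel_iff.1 hL
    refine isLocalKernel_iff.2 ⟨⟨F ∪ G, fun x y hxy => ?_⟩, fun g => ?_⟩
    · by_cases h : K x y = 0
      · obtain ⟨g, hg, he⟩ := hG x y fun h' => hxy (by simp [h, h'])
        exact ⟨g, Finset.mem_union_right _ hg, he⟩
      · obtain ⟨g, hg, he⟩ := hF x y h
        exact ⟨g, Finset.mem_union_left _ hg, he⟩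
    · obtain ⟨P, hP⟩ := hK g
      obtain ⟨P', hP'⟩ := hL g
      refine ⟨P ∪ P', fun x y hxy => ?_⟩
      simp only [Pi.add_apply]
      rw [hP x y fun a ha => hxy a (by simp at ha ⊢; exact Or.inl ha),
        hP' x y fun a ha => hxy a (by simp at ha ⊢; exact Or.inr ha)]
  smul_mem' := by
    intro c K hK
    obtain ⟨⟨F, hF⟩, hK⟩ := isLocalKernel_iff.1 hK
    refine isLocalKernel_iff.2 ⟨⟨F, fun x y hxy => hF x y fun h => hxy (by simp [h])⟩, fun g => ?_⟩
    obtain ⟨P, hP⟩ := hK g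
    exact ⟨P, fun x y hxy => by simp only [Pi.smul_apply]; rw [hP x y hxy]⟩

/-- The local kernel algebra, formed by the local kernels on the Schreier graph of `H`. -/
def LocalKernelAlgebra : Type _ := localKernels Q H

namespace LocalKernelAlgebra

instance : AddCommGroup (LocalKernelAlgebra Q H) := inferInstanceAs (AddCommGroup (localKernels Q H))

instance : Module ℂ (LocalKernelAlgebra Q H) := inferInstanceAs (Module ℂ (localKernels Q H))

instance : CoeFun (LocalKernelAlgebra Q H) fun _ => Γ ⧸ H → Γ ⧸ H → ℂ := ⟨fun K => K.1⟩

variable {Q H}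

@[ext]
theorem ext {K L : LocalKernelAlgebra Q H} (h : ∀ x y, K x y = L x y) : K = L :=
  Subtype.ext (funext fun x => funext fun y => h x y)

theorem add_apply (K L : LocalKernelAlgebra Q H) (x y : Γ ⧸ H) : (K + L) x y = K x y + L x y := rfl

theorem zero_apply (x y : Γ ⧸ H) : (0 : LocalKernelAlgebra Q H) x y = 0 := rfl

theorem smul_apply (c : ℂ) (K : LocalKernelAlgebra Q H) (x y : Γ ⧸ H) :
    (c • K) x y = c * K x y := rfl

theorem exists_supp (K : LocalKernelAlgebra Q H) :
    ∃ F : Finset Γ, ∀ x y, K x y ≠ 0 → ∃ g ∈ F, g • x = y :=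
  (isLocalKernel_iff.1 K.2).1

theorem exists_pattern (K : LocalKernelAlgebra Q H) (g : Γ) :
    ∃ P : Finset Γ, ∀ x y, SamePattern (P : Set Γ) x y → K x (g • x) = K y (g • y) :=
  (isLocalKernel_iff.1 K.2).2 g

theorem finite_row (K : LocalKernelAlgebra Q H) (x : Γ ⧸ H) : {y | K x y ≠ 0}.Finite := by
  classical
  obtain ⟨F, hF⟩ := K.exists_supp
  refine (F.image fun g => g • x).finite_toSet.subset fun y hy => ?_
  obtain ⟨g, hg, he⟩ := hF x y hy
  exact Finset.mem_coe.2 (Finset.mem_image.2 ⟨g, hg, he⟩)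

/-- Convolution `(KL)(x, y) = ∑_z K(x, z) L(z, y)`, a sum with finitely many nonzero terms. -/
instance : Mul (LocalKernelAlgebra Q H) where
  mul K L := ⟨fun x y => ∑' z, K x z * L z y, by
    classical
    obtain ⟨F, hF⟩ := K.exists_supp
    obtain ⟨G, hG⟩ := L.exists_supp
    choose P hP using K.exists_pattern
    choose P' hP' using L.exists_pattern
    refine isLocalKernel_iff.2 ⟨⟨G * F, fun x y hxy => ?_⟩, fun g => ?_⟩
    · obtain ⟨z, hz⟩ : ∃ z, K x z * L z y ≠ 0 := by
        by_contra! h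
        exact hxy (by simp [h])
      obtain ⟨a, ha, rfl⟩ := hF x z (left_ne_zero_of_mul hz)
      obtain ⟨b, hb, rfl⟩ := hG _ y (right_ne_zero_of_mul hz)
      exact ⟨b * a, Finset.mul_mem_mul hb ha, mul_smul _ _ _⟩
    · refine ⟨(F⁻¹ * F) ∪ F.biUnion P ∪
        F.biUnion fun h => (P' (g * h⁻¹)).image fun p => h⁻¹ * p * h, fun x y hxy => ?_⟩
      have hinj : ∀ a ∈ F, ∀ b ∈ F, (a • x = b • x ↔ a • y = b • y) := by
        intro a ha b hb
        have := hxy (b⁻¹ * a) (by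
          simp only [Finset.coe_union, Set.mem_union, Finset.mem_coe]
          exact Or.inl (Or.inl (Finset.mul_mem_mul (Finset.inv_mem_inv hb) ha)))
        rwa [mul_smul, mul_smul, inv_smul_eq_iff, inv_smul_eq_iff] at this
      obtain ⟨E, hEF, hE, hEx⟩ := Finset.exists_subset_injOn_image_eq_of_surjOn
        (f := fun a : Γ => a • x) (F : Set Γ) (F.image fun a => a • x) (by
          intro z hz; simpa using hz)
      have hEF' : ∀ a ∈ E, a ∈ F := fun a ha => by simpa using hEF ha
      have hrepx : ∀ a ∈ F, ∃ b ∈ E, b • x = a • x := by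
        intro a ha
        have : a • x ∈ E.image fun a => a • x := by
          rw [hEx]; exact Finset.mem_image_of_mem _ ha
        simpa using this
      have sumx : ∑' z, K x z * L z (g • x) = ∑ a ∈ E, K x (a • x) * L (a • x) (g • x) := by
        rw [tsum_eq_sum (s := E.image fun a => a • x), Finset.sum_image hE]
        intro z hz
        by_contra hne
        obtain ⟨a, ha, rfl⟩ := hF x z (left_ne_zero_of_mul hne)
        obtain ⟨b, hb, hba⟩ := hrepx a ha
        exact hz (Finset.mem_image.2 ⟨b, hb, hba⟩)
      have sumy : ∑' z, K y z * L z (g • y) = ∑ a ∈ E, K y (a • y) * L (a • y) (g • y) := by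
        have hE' : Set.InjOn (fun a : Γ => a • y) (E : Set Γ) := fun a ha b hb hab =>
          hE ha hb ((hinj a (hEF' a ha) b (hEF' b hb)).2 hab)
        rw [tsum_eq_sum (s := E.image fun a => a • y), Finset.sum_image hE']
        intro z hz
        by_contra hne
        obtain ⟨a, ha, rfl⟩ := hF y z (left_ne_zero_of_mul hne)
        obtain ⟨b, hb, hba⟩ := hrepx a ha
        exact hz (Finset.mem_image.2 ⟨b, hb, (hinj b (hEF' b hb) a ha).1 hba⟩)
      rw [sumx, sumy]
      refine Finset.sum_congr rfl fun a ha => ?_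
      have haF := hEF' a ha
      congr 1
      · refine hP a x y fun p hp => hxy p ?_
        simp only [Finset.coe_union, Set.mem_union, Finset.mem_coe]
        exact Or.inl (Or.inr (Finset.mem_biUnion.2 ⟨a, haF, hp⟩))
      · have := hP' (g * a⁻¹) (a • x) (a • y) fun p hp => by
          have := hxy (a⁻¹ * p * a) (by
            simp only [Finset.coe_union, Set.mem_union, Finset.mem_coe]
            exact Or.inr (Finset.mem_biUnion.2 ⟨a, haF, Finset.mem_image_of_mem _ hp⟩))
          simpa only [mul_smul, inv_smul_eq_iff] using this
        simpa only [← mul_smul, inv_mul_cancel_right] using this⟩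

theorem mul_apply (K L : LocalKernelAlgebra Q H) (x y : Γ ⧸ H) :
    (K * L) x y = ∑' z, K x z * L z y := rfl

open scoped Classical in
/-- The unit is the characteristic function of the diagonal. -/
instance : One (LocalKernelAlgebra Q H) where
  one := ⟨fun x y => if x = y then 1 else 0, isLocalKernel_iff.2 ⟨⟨{1}, fun x y hxy => by
      simpa using hxy⟩, fun g => ⟨{g}, fun x y hxy => by
        have : g • x = x ↔ g • y = y := hxy g (by simp)
        simp only [eq_comm (a := x), eq_comm (a := y), this]⟩⟩⟩

open scoped Classical in
theorem one_apply (x y : Γ ⧸ H) : (1 : LocalKernelAlgebra Q H) x y = if x = y then 1 else 0 := rfl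

/-- The involution `K*(x, y) = conj K(y, x)`. -/
instance : Star (LocalKernelAlgebra Q H) where
  star K := ⟨fun x y => starRingEnd ℂ (K y x), by
    classical
    obtain ⟨F, hF⟩ := K.exists_supp
    refine isLocalKernel_iff.2 ⟨⟨F⁻¹, fun x y hxy => ?_⟩, fun g => ?_⟩
    · obtain ⟨a, ha, rfl⟩ := hF y x fun h => hxy (by simp [h])
      exact ⟨a⁻¹, Finset.inv_mem_inv ha, by simp⟩
    · obtain ⟨P, hP⟩ := K.exists_pattern g⁻¹
      refine ⟨P.image fun p => g⁻¹ * p * g, fun x y hxy => ?_⟩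
      have := hP (g • x) (g • y) fun p hp => by
        have := hxy (g⁻¹ * p * g) (Finset.mem_coe.2 (Finset.mem_image_of_mem _ hp))
        simpa only [mul_smul, inv_smul_eq_iff] using this
      rw [inv_smul_smul, inv_smul_smul] at this
      rw [this]⟩

theorem star_apply (K : LocalKernelAlgebra Q H) (x y : Γ ⧸ H) :
    (star K) x y = starRingEnd ℂ (K y x) := rfl

/-! ### The regular representation -/

theorem exists_bound (K : LocalKernelAlgebra Q H) :
    ∃ (F : Finset Γ) (C : ℝ), 0 ≤ C ∧ (∀ x y, K x y ≠ 0 → ∃ g ∈ F, g • x = y) ∧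
      ∀ x y, ‖K x y‖ ≤ C := by
  classical
  obtain ⟨F, hF⟩ := K.exists_supp
  have hfin : ∀ g : Γ, ∃ C : ℝ, ∀ x, ‖K x (g • x)‖ ≤ C := by
    intro g
    obtain ⟨P, hP⟩ := K.exists_pattern g
    have : (Set.range fun x : Γ ⧸ H => ‖K x (g • x)‖).Finite := by
      have hfac : ∀ x y : Γ ⧸ H, P.filter (fun p => p • x = x) = P.filter (fun p => p • y = y) →
          ‖K x (g • x)‖ = ‖K y (g • y)‖ := by
        intro x y h
        rw [hP x y fun p hp => ?_]
        have := Finset.ext_iff.1 h p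
        simpa [Finset.mem_coe.1 hp] using this
      have hfin2 : (Set.range fun x : Γ ⧸ H => P.filter fun p => p • x = x).Finite :=
        (P.powerset.finite_toSet).subset (by
          rintro _ ⟨x, rfl⟩
          exact Finset.mem_coe.2 (Finset.mem_powerset.2 (Finset.filter_subset _ _)))
      let v : Finset Γ → ℝ := fun S => if h : ∃ x : Γ ⧸ H, P.filter (fun p => p • x = x) = S
        then ‖K h.choose (g • h.choose)‖ else 0
      refine (hfin2.image v).subset ?_
      rintro _ ⟨x, rfl⟩
      refine ⟨_, ⟨x, rfl⟩, ?_⟩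
      have hex : ∃ y : Γ ⧸ H, P.filter (fun p => p • y = y) = P.filter (fun p => p • x = x) :=
        ⟨x, rfl⟩
      simp only [v]
      rw [dif_pos hex]
      exact hfac _ _ hex.choose_spec
    obtain ⟨C, hC⟩ := this.bddAbove
    exact ⟨C, fun x => hC ⟨x, rfl⟩⟩
  choose C hC using hfin
  refine ⟨F, ∑ g ∈ F, |C g|, Finset.sum_nonneg fun _ _ => abs_nonneg _, hF, fun x y => ?_⟩
  by_cases h : K x y = 0
  · rw [h, norm_zero]
    exact Finset.sum_nonneg fun _ _ => abs_nonneg _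
  · obtain ⟨g, hg, rfl⟩ := hF x y h
    exact ((hC g x).trans (le_abs_self _)).trans
      (Finset.single_le_sum (f := fun g => |C g|) (fun _ _ => abs_nonneg _) hg)

theorem summable_row (K : LocalKernelAlgebra Q H) (x : Γ ⧸ H) (f : Γ ⧸ H → ℂ) :
    Summable fun y => K x y * f y :=
  summable_of_hasFiniteSupport ((K.finite_row x).subset fun _ hy => left_ne_zero_of_mul hy)

theorem exists_l2_bound (K : LocalKernelAlgebra Q H) :
    ∃ D : ℝ, 0 ≤ D ∧ ∀ f : Γ ⧸ H → ℂ, (Summable fun x => ‖f x‖ ^ 2) →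
      (Summable fun x => ‖∑' y, K x y * f y‖ ^ 2) ∧
      ∑' x, ‖∑' y, K x y * f y‖ ^ 2 ≤ D ^ 2 * ∑' x, ‖f x‖ ^ 2 := by
  classical
  obtain ⟨F, C, hC, hF, hKC⟩ := K.exists_bound
  refine ⟨C * F.card, by positivity, fun f hf => ?_⟩
  have hpt : ∀ x, ‖∑' y, K x y * f y‖ ^ 2 ≤ C ^ 2 * F.card * ∑ g ∈ F, ‖f (g • x)‖ ^ 2 := by
    intro x
    have h1 : ‖∑' y, K x y * f y‖ ≤ C * ∑ g ∈ F, ‖f (g • x)‖ := by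
      rw [tsum_eq_sum (s := F.image fun g => g • x)]
      · calc ‖∑ y ∈ F.image fun g => g • x, K x y * f y‖
            ≤ ∑ y ∈ F.image fun g => g • x, ‖K x y * f y‖ := norm_sum_le _ _
          _ ≤ ∑ y ∈ F.image fun g => g • x, C * ‖f y‖ := by
              refine Finset.sum_le_sum fun y _ => ?_
              rw [norm_mul]
              exact mul_le_mul_of_nonneg_right (hKC x y) (norm_nonneg _)
          _ ≤ ∑ g ∈ F, C * ‖f (g • x)‖ :=
              Finset.sum_image_le_of_nonneg fun _ _ => mul_nonneg hC (norm_nonneg _)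
          _ = C * ∑ g ∈ F, ‖f (g • x)‖ := by rw [Finset.mul_sum]
      · intro z hz
        by_contra hne
        obtain ⟨g, hg, he⟩ := hF x z (left_ne_zero_of_mul hne)
        exact hz (Finset.mem_image.2 ⟨g, hg, he⟩)
    calc ‖∑' y, K x y * f y‖ ^ 2 ≤ (C * ∑ g ∈ F, ‖f (g • x)‖) ^ 2 :=
          pow_le_pow_left₀ (norm_nonneg _) h1 2
      _ = C ^ 2 * (∑ g ∈ F, ‖f (g • x)‖) ^ 2 := mul_pow _ _ _
      _ ≤ C ^ 2 * (F.card * ∑ g ∈ F, ‖f (g • x)‖ ^ 2) :=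
          mul_le_mul_of_nonneg_left sq_sum_le_card_mul_sum_sq (sq_nonneg _)
      _ = _ := by ring
  have hg : ∀ g : Γ, Summable fun x : Γ ⧸ H => ‖f (g • x)‖ ^ 2 := fun g =>
    (MulAction.toPerm g : Equiv.Perm (Γ ⧸ H)).summable_iff (f := fun x => ‖f x‖ ^ 2) |>.2 hf
  have hg' : ∀ g : Γ, ∑' x : Γ ⧸ H, ‖f (g • x)‖ ^ 2 = ∑' x, ‖f x‖ ^ 2 := fun g =>
    (MulAction.toPerm g : Equiv.Perm (Γ ⧸ H)).tsum_eq fun x => ‖f x‖ ^ 2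
  have hs : Summable fun x : Γ ⧸ H => C ^ 2 * F.card * ∑ g ∈ F, ‖f (g • x)‖ ^ 2 :=
    (summable_sum fun g _ => hg g).mul_left _
  have hs' := Summable.of_nonneg_of_le (fun x => sq_nonneg _) hpt hs
  refine ⟨hs', (hs'.tsum_le_tsum hpt hs).trans_eq ?_⟩
  rw [tsum_mul_left, Summable.tsum_finsetSum fun g _ => hg g, Finset.sum_congr rfl fun g _ => hg' g,
    Finset.sum_const, nsmul_eq_mul]
  ring

/-- The Hilbert space `ℓ²(Γ/H)`. -/
abbrev L2 (H : Subgroup Γ) : Type _ := lp (fun _ : Γ ⧸ H => ℂ) 2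

theorem L2.summable (f : L2 H) : Summable fun x => ‖f x‖ ^ 2 := by
  simpa using (lp.memℓp f).summable (by simp)

theorem L2.norm_sq (f : L2 H) : ‖f‖ ^ 2 = ∑' x, ‖f x‖ ^ 2 := by
  simpa using lp.norm_rpow_eq_tsum (p := 2) (by simp) f

/-- The bounded operator `(Kf)(x) = ∑_y K(x, y) f(y)` on `ℓ²(Γ/H)` given by a local kernel. -/
def toOp (K : LocalKernelAlgebra Q H) : L2 H →L[ℂ] L2 H :=
  LinearMap.mkContinuousOfExistsBound
    { toFun := fun f => ⟨fun x => ∑' y, K x y * f y, memℓp_gen (by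
        obtain ⟨D, -, hD⟩ := K.exists_l2_bound
        simpa using (hD f (L2.summable f)).1)⟩
      map_add' := fun f g => lp.ext <| funext fun x => by
        simp only [lp.coeFn_add, Pi.add_apply, mul_add]
        exact (K.summable_row x f).tsum_add (K.summable_row x g)
      map_smul' := fun c f => lp.ext <| funext fun x => by
        simp only [lp.coeFn_smul, Pi.smul_apply, smul_eq_mul, RingHom.id_apply, ← tsum_mul_left]
        exact tsum_congr fun y => by ring }
    (by
      obtain ⟨D, hD0, hD⟩ := K.exists_l2_bound
      refine ⟨D, fun f => ?_⟩
      refine le_of_sq_le_sq ?_ (by positivity)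
      rw [mul_pow, L2.norm_sq, L2.norm_sq]
      exact (hD f (L2.summable f)).2)

theorem toOp_apply (K : LocalKernelAlgebra Q H) (f : L2 H) (x : Γ ⧸ H) :
    toOp K f x = ∑' y, K x y * f y := rfl

open scoped Classical in
theorem toOp_single (K : LocalKernelAlgebra Q H) (x y : Γ ⧸ H) :
    toOp K (lp.single 2 y (1 : ℂ)) x = K x y := by
  rw [toOp_apply, tsum_eq_single y]
  · rw [lp.single_apply_self, mul_one]
  · intro z hz
    rw [lp.single_apply_ne _ _ _ hz, mul_zero]

open scoped Classical in
theorem op_ext {S T : L2 H →L[ℂ] L2 H}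
    (h : ∀ x y, S (lp.single 2 y (1 : ℂ)) x = T (lp.single 2 y (1 : ℂ)) x) : S = T := by
  have hs : ∀ y (c : ℂ), S (lp.single 2 y c) = T (lp.single 2 y c) := by
    intro y c
    have hc : (lp.single 2 y c : L2 H) = c • lp.single 2 y (1 : ℂ) := by
      rw [← lp.single_smul]; simp
    rw [hc, map_smul, map_smul]
    congr 1
    exact lp.ext (funext fun x => h x y)
  ext1 f
  have hf := lp.hasSum_single (p := 2) ENNReal.ofNat_ne_top f
  have h1 := S.hasSum hf
  have h2 := T.hasSum hf
  simp only [hs] at h1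
  exact h1.unique h2

theorem toOp_injective : Function.Injective (toOp (Q := Q) (H := H)) := by
  classical
  intro K L h
  ext x y
  rw [← toOp_single, ← toOp_single, h]

theorem toOp_add (K L : LocalKernelAlgebra Q H) : toOp (K + L) = toOp K + toOp L := by
  refine op_ext fun x y => ?_
  rw [_root_.add_apply, lp.coeFn_add, Pi.add_apply]
  simp only [toOp_single, add_apply]

theorem toOp_zero : toOp (0 : LocalKernelAlgebra Q H) = 0 := by
  simpa using toOp_add (0 : LocalKernelAlgebra Q H) 0

theorem toOp_smul (c : ℂ) (K : LocalKernelAlgebra Q H) : toOp (c • K) = c • toOp K := by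
  refine op_ext fun x y => ?_
  rw [_root_.smul_apply, lp.coeFn_smul, Pi.smul_apply]
  simp only [toOp_single, smul_apply, smul_eq_mul]

theorem toOp_mul (K L : LocalKernelAlgebra Q H) : toOp (K * L) = toOp K * toOp L := by
  refine op_ext fun x y => ?_
  rw [mul_apply_eq_comp, toOp_apply K]
  simp only [toOp_single, mul_apply]

theorem toOp_one : toOp (1 : LocalKernelAlgebra Q H) = 1 := by
  classical
  refine op_ext fun x y => ?_
  rw [toOp_single, one_apply, one_apply_eq_self, lp.single_apply, Pi.single_apply]

theorem toOp_star (K : LocalKernelAlgebra Q H) : toOp (star K) = star (toOp K) := by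
  classical
  refine op_ext fun x y => ?_
  rw [toOp_single, star_apply, ContinuousLinearMap.star_eq_adjoint]
  have h := lp.inner_single_left (𝕜 := ℂ) x (1 : ℂ)
    (ContinuousLinearMap.adjoint (toOp K) (lp.single 2 y (1 : ℂ)))
  rw [ContinuousLinearMap.adjoint_inner_right, lp.inner_single_right, toOp_single] at h
  simpa using h

instance : Ring (LocalKernelAlgebra Q H) :=
  { (inferInstance : AddCommGroup (LocalKernelAlgebra Q H)),
    (inferInstance : Mul (LocalKernelAlgebra Q H)),
    (inferInstance : One (LocalKernelAlgebra Q H)) with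
    left_distrib := fun a b c => toOp_injective (by simp only [toOp_mul, toOp_add, mul_add])
    right_distrib := fun a b c => toOp_injective (by simp only [toOp_mul, toOp_add, add_mul])
    zero_mul := fun a => toOp_injective (by simp only [toOp_mul, toOp_zero, zero_mul])
    mul_zero := fun a => toOp_injective (by simp only [toOp_mul, toOp_zero, mul_zero])
    mul_assoc := fun a b c => toOp_injective (by simp only [toOp_mul, mul_assoc])
    one_mul := fun a => toOp_injective (by simp only [toOp_mul, toOp_one, one_mul])
    mul_one := fun a => toOp_injective (by simp only [toOp_mul, toOp_one, mul_one]) }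

instance : Algebra ℂ (LocalKernelAlgebra Q H) :=
  Algebra.ofModule
    (fun c a b => toOp_injective (by simp only [toOp_mul, toOp_smul, smul_mul_assoc]))
    (fun c a b => toOp_injective (by simp only [toOp_mul, toOp_smul, mul_smul_comm]))

instance : StarRing (LocalKernelAlgebra Q H) where
  star_involutive a := toOp_injective (by simp only [toOp_star, star_star])
  star_mul a b := toOp_injective (by simp only [toOp_star, toOp_mul, star_mul])
  star_add a b := toOp_injective (by simp only [toOp_star, toOp_add, star_add])

variable (Q H) in
/-- The regular representation of the local kernel algebra on `ℓ²(Γ/H)`. -/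
def regularRep : LocalKernelAlgebra Q H →⋆ₐ[ℂ] (L2 H →L[ℂ] L2 H) where
  toFun := toOp
  map_one' := toOp_one
  map_mul' := toOp_mul
  map_zero' := toOp_zero
  map_add' := toOp_add
  commutes' c := by
    rw [Algebra.algebraMap_eq_smul_one, Algebra.algebraMap_eq_smul_one, toOp_smul, toOp_one]
  map_star' := toOp_star

end LocalKernelAlgebra

/-- The reduced C*-algebra: the completion of the local kernel algebra in the norm induced by its
regular representation (which is faithful), realised as the norm closure of its image in the
bounded operators on `ℓ²(Γ/H)`. -/
def reducedCStar : StarSubalgebra ℂ (LocalKernelAlgebra.L2 H →L[ℂ] LocalKernelAlgebra.L2 H) :=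
  (LocalKernelAlgebra.regularRep Q H).range.topologicalClosure

instance : IsClosed (reducedCStar Q H : Set (LocalKernelAlgebra.L2 H →L[ℂ] LocalKernelAlgebra.L2 H)) :=
  StarSubalgebra.isClosed_topologicalClosure _

end Schreier

/-- A C*-algebra is simple if it is nonzero and its only closed two-sided ideals are
`0` and the whole algebra. -/
def IsSimpleCStarAlgebra (A : Type*) [CStarAlgebra A] : Prop :=
  Nontrivial A ∧ ∀ I : TwoSidedIdeal A, IsClosed (I : Set A) → I = ⊥ ∨ I = ⊤

end Elek

end

open scoped Pointwise ENNReal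

noncomputable section

namespace Elek

/-! ### Compactness of the space of subgroups and minimality of `Z`. -/

section SubgroupSpace

variable {Γ : Type*} [Group Γ]

/-! A point of `Γ/H` is studied through its stabiliser, an element of `Z`; the points whose
stabiliser agrees with that of `x` on a finite set `P` form a basic neighbourhood `U` of `x`, and
the indicator of `U` is a diagonal local kernel, a projection `p`.

Genericity makes the action free at the level of stabilisers: if `g` moves `x`, then `g` does not
normalise the stabiliser of `x`, so `x` and `g • x` have different stabilisers, and a small enough
`U` is disjoint from its translate by `g` (`IsGeneric.exists_finset_not_samePattern`). A local
kernel `K` is carried by finitely many group elements, so for small `U` the compression `p K p` is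
the scalar multiple `K x x • p` (`exists_indicator_compress`).

Let `I` be a nonzero ideal. A multiple `b` of some `star a * a` with `a ∈ I` has diagonal
coefficient 1 at some `x`. Approximating `b` by a local kernel shows that `p * b * p` is at distance
less than 1 from `p`, hence invertible in the corner of `p`, so `p` lies in `I`
(`exists_indicator_mem`). By minimality and compactness of `Z`, finitely many translates of `U`
cover `Γ/H` (`IsURS.exists_finset_samePattern`), so the indicators of these translates, all in `I`,
generate the unit (`one_mem_of_indicator_mem`). -/

theorem mem_conj_iff {γ g : Γ} {H : Subgroup Γ} : g ∈ conj γ H ↔ γ⁻¹ * g * γ ∈ H := by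
  unfold conj
  rw [Subgroup.mem_map_equiv]
  simp

theorem isClopen_setOf_mem (γ : Γ) : IsClopen {L : Subgroup Γ | γ ∈ L} := by
  classical
  have hc : Continuous fun (L : Subgroup Γ) (γ : Γ) => decide (γ ∈ L) := by
    have := continuous_induced_dom (f := fun (H : Subgroup Γ) (γ : Γ) => decide (γ ∈ H))
      (t := inferInstance)
    convert this
  have := (isClopen_discrete ({true} : Set Bool)).preimage ((continuous_apply γ).comp hc)
  convert this using 1
  ext L
  simp

/-- Subgroups form a closed subset of the compact space `Γ → Bool`: each instance of a subgroup
axiom involves finitely many coordinates, hence is a clopen condition. -/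
instance : CompactSpace (Subgroup Γ) := by
  classical
  let f : Subgroup Γ → Γ → Bool := fun L γ => decide (γ ∈ L)
  have hf : Topology.IsInducing f := ⟨by
    unfold subgroupTopology f
    congr!⟩
  have hcl : ∀ g : Γ, IsClopen {φ : Γ → Bool | φ g = true} := fun g =>
    (isClopen_discrete ({true} : Set Bool)).preimage (continuous_apply g)
  -- Each implication among the axioms is written as a union with a complement, so that closedness
  -- can be read off.
  have hrange : Set.range f = {φ | φ 1 = true} ∩
      ((⋂ a, ⋂ b, ({φ | φ a = true}ᶜ ∪ ({φ | φ b = true}ᶜ ∪ {φ | φ (a * b) = true}))) ∩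
      ⋂ a, ({φ | φ a = true}ᶜ ∪ {φ | φ a⁻¹ = true})) := by
    ext φ
    constructor
    · rintro ⟨L, rfl⟩
      simp only [f, Set.mem_inter_iff, Set.mem_iInter, Set.mem_union, Set.mem_compl_iff,
        Set.mem_ofPred_eq, decide_eq_true_eq]
      refine ⟨L.one_mem, fun a b => ?_, fun a => ?_⟩
      · by_cases ha : a ∈ L
        · by_cases hb : b ∈ L
          · exact Or.inr (Or.inr (L.mul_mem ha hb))
          · exact Or.inr (Or.inl hb)
        · exact Or.inl ha
      · simp only [inv_mem_iff]
        exact (em _).symm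
    · simp only [Set.mem_inter_iff, Set.mem_iInter, Set.mem_union, Set.mem_compl_iff,
        Set.mem_ofPred_eq]
      rintro ⟨h1, h2, h3⟩
      refine ⟨{ carrier := {γ | φ γ = true}, one_mem' := h1, mul_mem' := ?_, inv_mem' := ?_ }, ?_⟩
      · intro a b ha hb
        exact ((h2 a b).resolve_left (not_not.2 ha)).resolve_left (not_not.2 hb)
      · intro a ha
        exact (h3 a).resolve_left (not_not.2 ha)
      · funext γ
        rw [Bool.eq_iff_iff]
        exact decide_eq_true_iff
  have hclosed : IsClosed (Set.range f) := by
    rw [hrange]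
    refine (hcl 1).isClosed.inter (IsClosed.inter ?_ ?_)
    · exact isClosed_iInter fun a => isClosed_iInter fun b =>
        ((hcl a).compl.union ((hcl b).compl.union (hcl _))).isClosed
    · exact isClosed_iInter fun a => ((hcl a).compl.union (hcl _)).isClosed
  refine ⟨hf.isCompact_iff.2 ?_⟩
  rw [Set.image_univ]
  exact hclosed.isCompact

/-- Every orbit in `Z` meets the cylinder neighbourhood of `L` given by `P`, so the preimages of
this cylinder under conjugations are an open cover of the compact set `Z`. A finite subcover gives a
`G` that serves all `M` at once. -/
theorem IsURS.exists_finset_conj {Z : Set (Subgroup Γ)} (hZ : IsURS Z) {L : Subgroup Γ}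
    (hL : L ∈ Z) (P : Finset Γ) :
    ∃ G : Finset Γ, ∀ M ∈ Z, ∃ g ∈ G, ∀ p ∈ P, p ∈ L ↔ p ∈ conj g M := by
  have hclopen : ∀ (g p : Γ), IsClopen {M : Subgroup Γ | p ∈ L ↔ p ∈ conj g M} := by
    intro g p
    simp only [mem_conj_iff]
    by_cases h : p ∈ L
    · simpa only [h, true_iff] using isClopen_setOf_mem _
    · simp only [h, false_iff]
      exact (isClopen_setOf_mem _).compl
  let V : Γ → Set (Subgroup Γ) := fun g => ⋂ p ∈ P, {M | p ∈ L ↔ p ∈ conj g M}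
  have hV : ∀ g, IsOpen (V g) := fun g =>
    isOpen_biInter_finset fun p _ => (hclopen g p).isOpen
  have hcover : Z ⊆ ⋃ g, V g := by
    intro M hM
    have hmem : L ∈ V 1 := by simp [V, mem_conj_iff]
    obtain ⟨_, hK, g, rfl⟩ := mem_closure_iff.1 (hZ.minimal M hM hL) _ (hV 1) hmem
    refine Set.mem_iUnion.2 ⟨g, ?_⟩
    simpa [V, mem_conj_iff] using hK
  obtain ⟨G, hG⟩ := hZ.isClosed.isCompact.elim_finite_subcover V hV hcover
  refine ⟨G, fun M hM => ?_⟩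
  obtain ⟨g, hg, h⟩ := Set.mem_iUnion₂.1 (hG hM)
  exact ⟨g, hg, fun p hp => Set.mem_iInter₂.1 h p hp⟩

/-! ### Stabilisers of points of `Γ/H`. -/

variable {H : Subgroup Γ}

/-- The dictionary between vertices and subgroups: the coset of `a` has stabiliser `conj a H`, so
facts about `Z` become facts about fixed points. -/
theorem smul_mk_eq_iff {a g : Γ} :
    g • (QuotientGroup.mk a : Γ ⧸ H) = QuotientGroup.mk a ↔ g ∈ conj a H := by
  rw [mem_conj_iff, eq_comm, ← QuotientGroup.mk_mul_of_mem a H.one_mem, mul_one,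
    MulAction.Quotient.smul_mk, QuotientGroup.eq, smul_eq_mul, mul_assoc]

theorem conj_mul (a b : Γ) (L : Subgroup Γ) : conj (a * b) L = conj a (conj b L) := by
  ext g
  simp only [mem_conj_iff, mul_inv_rev, mul_assoc]

theorem SamePattern.mono {P P' : Set Γ} (h : P ⊆ P') {x y : Γ ⧸ H} (hxy : SamePattern P' x y) :
    SamePattern P x y := fun g hg => hxy g (h hg)

theorem IsURS.exists_finset_samePattern {Z : Set (Subgroup Γ)} (hZ : IsURS Z) (hH : H ∈ Z)
    (P : Finset Γ) (x : Γ ⧸ H) :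
    ∃ G : Finset Γ, ∀ y : Γ ⧸ H, ∃ g ∈ G, SamePattern (P : Set Γ) x (g • y) := by
  induction x using QuotientGroup.induction_on with | H a
  obtain ⟨G, hG⟩ := hZ.exists_finset_conj (hZ.conj_mem a H hH) P
  refine ⟨G, fun y => ?_⟩
  induction y using QuotientGroup.induction_on with | H b
  obtain ⟨g, hg, h⟩ := hG _ (hZ.conj_mem b H hH)
  refine ⟨g, hg, fun p hp => ?_⟩
  change p • (QuotientGroup.mk a : Γ ⧸ H) = QuotientGroup.mk a ↔
    p • (QuotientGroup.mk (g * b) : Γ ⧸ H) = QuotientGroup.mk (g * b)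
  rw [smul_mk_eq_iff, smul_mk_eq_iff, conj_mul]
  exact h p hp

/-- In the generic case, an element moving `x` moves all points near `x` away from `x`. -/
theorem IsGeneric.exists_finset_not_samePattern {Z : Set (Subgroup Γ)} (hgen : IsGeneric Z)
    (hZ : IsURS Z) (hH : H ∈ Z) (g : Γ) (x : Γ ⧸ H) (hg : g • x ≠ x) :
    ∃ P : Finset Γ, ∀ y : Γ ⧸ H, SamePattern (P : Set Γ) x y →
      ¬ SamePattern (P : Set Γ) x (g • y) := by
  classical
  -- Otherwise `g` normalises the stabiliser of `x`, which is a member of `Z`, and genericity puts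
  -- `g` in it, against `hg`.
  have hne : ∃ h : Γ, ¬ (h • x = x ↔ (g⁻¹ * h * g) • x = x) := by
    induction x using QuotientGroup.induction_on with | H a
    by_contra! hall
    refine hg (smul_mk_eq_iff.2 ?_)
    rw [← SetLike.mem_coe, ← hgen _ (hZ.conj_mem a H hH)]
    ext h
    rw [mem_conj_iff, ← smul_mk_eq_iff, ← smul_mk_eq_iff, hall h]
  obtain ⟨h, hh⟩ := hne
  -- `h` fixes `g • y` exactly when `g⁻¹ * h * g` fixes `y`; if both points looked like `x` on these
  -- two elements, the equivalence refuted by `h` would hold at `x`.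
  refine ⟨{h, g⁻¹ * h * g}, fun y h1 h2 => hh ?_⟩
  have e1 := h1 (g⁻¹ * h * g) (by simp)
  have e2 := h2 h (by simp)
  rw [e1, e2, mul_assoc, mul_smul, inv_smul_eq_iff, mul_smul]

end SubgroupSpace

/-! ### Diagonal kernels, translations and compressions. -/

section Kernels

variable {Γ : Type*} [Group Γ] {Q : GeneratingSystem Γ} {H : Subgroup Γ}

/-- A set of vertices is local if membership of `x` in it depends only on which elements of some
finite subset of the group fix `x`. -/
def IsLocalSet (S : Set (Γ ⧸ H)) : Prop :=
  ∃ P : Finset Γ, ∀ x y, SamePattern (P : Set Γ) x y → (x ∈ S ↔ y ∈ S)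

theorem isLocalSet_setOf_samePattern (P : Finset Γ) (x : Γ ⧸ H) :
    IsLocalSet {y | SamePattern (P : Set Γ) x y} :=
  ⟨P, fun _ _ h => forall₂_congr fun g hg => by rw [h g hg]⟩

namespace LocalKernelAlgebra

open scoped Classical in
variable (Q) in
/-- The indicator function of a local set, as a diagonal kernel. -/
def indicator (S : Set (Γ ⧸ H)) (hS : IsLocalSet S) : LocalKernelAlgebra Q H :=
  ⟨fun x y => if x = y ∧ x ∈ S then 1 else 0, isLocalKernel_iff.2 ⟨⟨{1}, fun x y hxy => by
      have : x = y ∧ x ∈ S := by simpa using hxy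
      simpa using this.1⟩, fun g => by
    obtain ⟨P, hP⟩ := hS
    -- Besides membership in `S`, the value at `(x, g • x)` depends on whether `g` fixes `x`.
    refine ⟨insert g P, fun x y hxy => ?_⟩
    have h1 : x = g • x ↔ y = g • y := by
      simpa only [eq_comm] using hxy g (by simp)
    have h2 : x ∈ S ↔ y ∈ S := hP x y (hxy.mono (by simp))
    simp only [h1, h2]⟩⟩

open scoped Classical in
theorem indicator_apply (S : Set (Γ ⧸ H)) (hS : IsLocalSet S) (x y : Γ ⧸ H) :
    indicator Q S hS x y = if x = y ∧ x ∈ S then 1 else 0 := rfl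

open scoped Classical in
variable (Q H) in
/-- The translation by a group element, as a kernel. -/
def translation (g : Γ) : LocalKernelAlgebra Q H :=
  ⟨fun x y => if g • x = y then 1 else 0, isLocalKernel_iff.2 ⟨⟨{g}, fun x y hxy => by
      simpa using hxy⟩, fun h => ⟨{g⁻¹ * h}, fun x y hxy => by
        have : g • x = h • x ↔ g • y = h • y := by
          have := hxy (g⁻¹ * h) (by simp)
          rwa [mul_smul, mul_smul, inv_smul_eq_iff, inv_smul_eq_iff, eq_comm,
            eq_comm (a := h • y)] at this
        simp only [this]⟩⟩⟩

open scoped Classical in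
theorem translation_apply (g : Γ) (x y : Γ ⧸ H) :
    translation Q H g x y = if g • x = y then 1 else 0 := rfl

open scoped Classical in
theorem indicator_mul_apply (S : Set (Γ ⧸ H)) (hS : IsLocalSet S) (K : LocalKernelAlgebra Q H)
    (x y : Γ ⧸ H) : (indicator Q S hS * K) x y = if x ∈ S then K x y else 0 := by
  rw [mul_apply, tsum_eq_single x]
  · simp [indicator_apply]
  · intro z hz
    simp [indicator_apply, hz.symm]

open scoped Classical in
theorem mul_indicator_apply (S : Set (Γ ⧸ H)) (hS : IsLocalSet S) (K : LocalKernelAlgebra Q H)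
    (x y : Γ ⧸ H) : (K * indicator Q S hS) x y = if y ∈ S then K x y else 0 := by
  rw [mul_apply, tsum_eq_single y]
  · simp [indicator_apply]
  · intro z hz
    simp [indicator_apply, hz]

theorem translation_mul_apply (g : Γ) (K : LocalKernelAlgebra Q H) (x y : Γ ⧸ H) :
    (translation Q H g * K) x y = K (g • x) y := by
  rw [mul_apply, tsum_eq_single (g • x)]
  · simp [translation_apply]
  · intro z hz
    simp [translation_apply, hz.symm]

/-- Combined with `translation_mul_apply`, this shows that conjugating by a translation turns `K x
y` into `K (g • x) (g • y)`; the indicator of `S` becomes that of `g⁻¹ • S`. -/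
theorem mul_translation_inv_apply (g : Γ) (K : LocalKernelAlgebra Q H) (x y : Γ ⧸ H) :
    (K * translation Q H g⁻¹) x y = K x (g • y) := by
  rw [mul_apply, tsum_eq_single (g • y)]
  · simp [translation_apply]
  · intro z hz
    have : g⁻¹ • z ≠ y := fun h => hz (inv_smul_eq_iff.1 h)
    simp [translation_apply, this]

theorem isStarProjection_indicator (S : Set (Γ ⧸ H)) (hS : IsLocalSet S) :
    IsStarProjection (indicator Q S hS) := by
  constructor
  · ext x y
    rw [indicator_mul_apply]
    by_cases h : x ∈ S <;> simp [indicator_apply, h]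
  · ext x y
    rw [star_apply, indicator_apply, indicator_apply]
    by_cases h : x = y
    · subst h; split_ifs <;> simp
    · simp [h, Ne.symm h]

/-- Near `x`, a local kernel is compressed to a multiple of the identity. -/
theorem exists_indicator_compress {Z : Set (Subgroup Γ)} (hZ : IsURS Z) (hgen : IsGeneric Z)
    (hH : H ∈ Z) (K : LocalKernelAlgebra Q H) (x : Γ ⧸ H) :
    ∃ P : Finset Γ, ∀ hS : IsLocalSet {y : Γ ⧸ H | SamePattern (P : Set Γ) x y},
      indicator Q _ hS * K * indicator Q _ hS = K x x • indicator Q _ hS := by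
  classical
  obtain ⟨F, hF⟩ := K.exists_supp
  obtain ⟨P₀, hP₀⟩ := K.exists_pattern 1
  have hmove : ∀ g : Γ, ∃ P : Finset Γ, g • x ≠ x → ∀ y : Γ ⧸ H, SamePattern (P : Set Γ) x y →
      ¬ SamePattern (P : Set Γ) x (g • y) := by
    intro g
    by_cases hg : g • x = x
    · exact ⟨∅, fun h => absurd hg h⟩
    · obtain ⟨P, hP⟩ := hgen.exists_finset_not_samePattern hZ hH g x hg
      exact ⟨P, fun _ => hP⟩
  choose P hP using hmove
  -- `P₀` keeps the diagonal values equal to `K x x`, `F` ensures that an element of the support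
  -- moving `y` also moves `x`, and the sets `P g` then keep `y` and `g • y` from both having the
  -- pattern of `x`.
  let R : Finset Γ := P₀ ∪ F ∪ F.biUnion P
  have hR₀ : (P₀ : Set Γ) ⊆ R := fun p hp => by simp [R, Finset.mem_coe.1 hp]
  have hRF : (F : Set Γ) ⊆ R := fun p hp => by simp [R, Finset.mem_coe.1 hp]
  have hRP : ∀ g ∈ F, (P g : Set Γ) ⊆ R := fun g hg p hp =>
    Finset.mem_union_right _ (Finset.mem_biUnion.2 ⟨g, hg, hp⟩)
  refine ⟨R, fun hS => ?_⟩
  ext y z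
  rw [mul_indicator_apply, indicator_mul_apply, smul_apply, indicator_apply]
  simp only [Set.mem_ofPred_eq]
  by_cases hy : SamePattern (R : Set Γ) x y
  · by_cases hyz : y = z
    · subst hyz
      have := hP₀ x y (hy.mono hR₀)
      simp only [one_smul] at this
      simp [hy, this]
    · by_cases hz : SamePattern (R : Set Γ) x z
      · simp only [hy, hz, hyz, if_true, false_and, if_false, mul_zero]
        by_contra hne
        obtain ⟨g, hg, rfl⟩ := hF y z hne
        have hgx : g • x ≠ x := fun h => hyz ((hy g (hRF hg)).1 h).symm
        exact hP g hgx y (hy.mono (hRP g hg)) (hz.mono (hRP g hg))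
      · simp [hz, hyz]
  · simp [hy]

/-! ### Approximation by local kernels, and covering by translates of a pattern. -/

variable (Q H) in
/-- The inclusion of the local kernel algebra into the reduced C*-algebra. -/
def toReduced : LocalKernelAlgebra Q H →⋆ₐ[ℂ] reducedCStar Q H :=
  (regularRep Q H).codRestrict _ fun K =>
    StarSubalgebra.le_topologicalClosure _ ⟨K, rfl⟩

theorem coe_toReduced (K : LocalKernelAlgebra Q H) : (toReduced Q H K : L2 H →L[ℂ] L2 H) = toOp K :=
  rfl

theorem exists_toReduced_norm_sub_lt (a : reducedCStar Q H) {ε : ℝ} (hε : 0 < ε) :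
    ∃ K : LocalKernelAlgebra Q H, ‖a - toReduced Q H K‖ < ε := by
  have ha : (a : L2 H →L[ℂ] L2 H) ∈ closure ((regularRep Q H).range : Set (L2 H →L[ℂ] L2 H)) := by
    rw [← StarSubalgebra.topologicalClosure_coe]
    exact a.2
  obtain ⟨_, ⟨K, rfl⟩, hK⟩ := Metric.mem_closure_iff.1 ha ε hε
  refine ⟨K, ?_⟩
  rwa [dist_eq_norm] at hK

/-- A two-sided ideal containing the indicator function of some nonempty pattern is everything. -/
theorem one_mem_of_indicator_mem {Z : Set (Subgroup Γ)} (hZ : IsURS Z) (hH : H ∈ Z)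
    (I : TwoSidedIdeal (LocalKernelAlgebra Q H)) (P : Finset Γ) (x : Γ ⧸ H)
    (hS : IsLocalSet {y : Γ ⧸ H | SamePattern (P : Set Γ) x y})
    (hI : indicator Q _ hS ∈ I) : (1 : LocalKernelAlgebra Q H) ∈ I := by
  classical
  obtain ⟨G, hG⟩ := hZ.exists_finset_samePattern hH P x
  -- The ideal contains the indicator of every finite union of translates of the pattern set.
  have key : ∀ G : Finset Γ, ∃ K ∈ I, ∀ y z : Γ ⧸ H, K y z =
      if y = z ∧ ∃ g ∈ G, SamePattern (P : Set Γ) x (g • y) then 1 else 0 := by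
    intro G
    induction G using Finset.induction_on with
    | empty => exact ⟨0, I.zero_mem, fun y z => by simp [zero_apply]⟩
    | insert g G _ ih =>
      obtain ⟨K, hK, hKv⟩ := ih
      let p := translation Q H g * indicator Q _ hS * translation Q H g⁻¹
      have hp : p ∈ I := I.mul_mem_right _ _ (I.mul_mem_left _ _ hI)
      have hpv : ∀ y z, p y z = if y = z ∧ SamePattern (P : Set Γ) x (g • y) then 1 else 0 := by
        intro y z
        simp only [p]
        rw [mul_translation_inv_apply, translation_mul_apply, indicator_apply]
        simp
      -- `K` and `p` are commuting diagonal projections, and `K + p - K * p` is their supremum.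
      refine ⟨K + (p - K * p), I.add_mem hK (I.sub_mem hp (I.mul_mem_left _ _ hp)), fun y z => ?_⟩
      have hmul : (K * p) y z = K y y * p y z := by
        rw [mul_apply, tsum_eq_single y]
        intro w hw
        simp [hKv, hw.symm]
      have hsub : (K + (p - K * p)) y z = K y z + (p y z - (K * p) y z) := rfl
      rw [hsub, hmul, hpv, hKv, hKv]
      by_cases hyz : y = z
      · subst hyz
        by_cases h1 : SamePattern (P : Set Γ) x (g • y) <;>
          by_cases h2 : ∃ h ∈ G, SamePattern (P : Set Γ) x (h • y) <;> simp [h1, h2]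
      · simp [hyz]
  obtain ⟨K, hK, hKv⟩ := key G
  convert hK
  ext y z
  rw [hKv, one_apply]
  simp [hG y]

end LocalKernelAlgebra

end Kernels

/-! ### Ideals of the reduced C*-algebra. -/

section Simplicity

open LocalKernelAlgebra

variable {Γ : Type*} [Group Γ] {Q : GeneratingSystem Γ} {H : Subgroup Γ}

open scoped Classical in
theorem LocalKernelAlgebra.norm_matrixCoeff_le (T : L2 H →L[ℂ] L2 H) (x y : Γ ⧸ H) :
    ‖T (lp.single 2 y (1 : ℂ)) x‖ ≤ ‖T‖ := by
  refine (lp.norm_apply_le_norm (by simp) _ x).trans ((T.le_opNorm _).trans_eq ?_)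
  rw [lp.norm_single (by simp), norm_one, mul_one]

open scoped Classical in
-- Compression to a small pattern only sees diagonal coefficients, which may all vanish for a
-- nonzero `T`. Passing to `star T * T` turns a nonzero column into a positive diagonal entry.
theorem LocalKernelAlgebra.star_mul_self_matrixCoeff (T : L2 H →L[ℂ] L2 H) (x : Γ ⧸ H) :
    (star T * T) (lp.single 2 x (1 : ℂ)) x = ((‖T (lp.single 2 x (1 : ℂ))‖ ^ 2 : ℝ) : ℂ) := by
  have h := lp.inner_single_left (𝕜 := ℂ) x (1 : ℂ)
    (ContinuousLinearMap.adjoint T (T (lp.single 2 x (1 : ℂ))))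
  rw [ContinuousLinearMap.adjoint_inner_right, inner_self_eq_norm_sq_to_K] at h
  rw [ContinuousLinearMap.star_eq_adjoint]
  simpa using h.symm

/-- A nonzero ideal of the reduced C*-algebra contains the indicator function of a nonempty
pattern. -/
theorem exists_indicator_mem {Z : Set (Subgroup Γ)} (hZ : IsURS Z) (hgen : IsGeneric Z)
    (hH : H ∈ Z) (I : TwoSidedIdeal (reducedCStar Q H)) (hI : I ≠ ⊥) :
    ∃ (P : Finset Γ) (x : Γ ⧸ H) (hS : IsLocalSet {y : Γ ⧸ H | SamePattern (P : Set Γ) x y}),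
      toReduced Q H (indicator Q _ hS) ∈ I := by
  classical
  obtain ⟨a, haI, ha⟩ : ∃ a ∈ I, a ≠ 0 := by
    by_contra! h
    exact hI (le_bot_iff.1 fun a ha => (TwoSidedIdeal.mem_bot _).2 (h a ha))
  obtain ⟨x, hx⟩ : ∃ x, (a : L2 H →L[ℂ] L2 H) (lp.single 2 x (1 : ℂ)) ≠ 0 := by
    by_contra! h
    refine ha (Subtype.ext (op_ext fun y x => ?_))
    simp [h]
  let c : ℝ := ‖(a : L2 H →L[ℂ] L2 H) (lp.single 2 x (1 : ℂ))‖ ^ 2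
  have hc : 0 < c := by positivity
  -- The scalar makes the diagonal coefficient of `b` at `x` equal to 1.
  let b : reducedCStar Q H := ((c : ℂ)⁻¹ • star a) * a
  have hbI : b ∈ I := I.mul_mem_left _ _ haI
  have hbx : (b : L2 H →L[ℂ] L2 H) (lp.single 2 x (1 : ℂ)) x = 1 := by
    have h := star_mul_self_matrixCoeff (a : L2 H →L[ℂ] L2 H) x
    have hb : (b : L2 H →L[ℂ] L2 H) =
        (c : ℂ)⁻¹ • (star (a : L2 H →L[ℂ] L2 H) * (a : L2 H →L[ℂ] L2 H)) :=
      smul_mul_assoc _ _ _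
    rw [hb, _root_.smul_apply, lp.coeFn_smul, Pi.smul_apply, h]
    exact inv_mul_cancel₀ (Complex.ofReal_ne_zero.2 hc.ne')
  -- The error enters twice below, once as `‖b - K‖` and once as `‖K x x - 1‖`; one half each keeps
  -- the sum below 1.
  obtain ⟨K, hK⟩ := exists_toReduced_norm_sub_lt b (ε := 1 / 2) (by norm_num)
  obtain ⟨P, hP⟩ := exists_indicator_compress hZ hgen hH K x
  have hS := isLocalSet_setOf_samePattern P x
  refine ⟨P, x, hS, ?_⟩
  set p := toReduced Q H (indicator Q _ hS) with hp
  have hproj : IsStarProjection p := (isStarProjection_indicator _ hS).map (toReduced Q H)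
  have hpp : p * p = p := hproj.isIdempotentElem
  have hp1 : ‖p‖ ≤ 1 := hproj.norm_le
  have hpK : p * toReduced Q H K * p = K x x • p := by
    rw [hp, ← map_mul, ← map_mul, hP hS, map_smul]
  have hKx : ‖K x x - 1‖ < 1 / 2 := by
    have h := norm_matrixCoeff_le ((toReduced Q H K - b : reducedCStar Q H) : L2 H →L[ℂ] L2 H) x x
    have e : ((toReduced Q H K - b : reducedCStar Q H) : L2 H →L[ℂ] L2 H) =
      toOp K - (b : L2 H →L[ℂ] L2 H) := rfl
    rw [e, _root_.sub_apply, lp.coeFn_sub, Pi.sub_apply, hbx, toOp_single] at h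
    refine h.trans_lt ?_
    rw [norm_sub_rev] at hK
    exact hK
  let r := p * b * p - p
  have hr : ‖r‖ < 1 := by
    have e : r = p * (b - toReduced Q H K) * p + (K x x - 1) • p := by
      rw [mul_sub, sub_mul, hpK, sub_smul, one_smul]
      simp only [r]
      abel
    have h1 : ‖p * (b - toReduced Q H K) * p‖ ≤ ‖b - toReduced Q H K‖ := by
      calc ‖p * (b - toReduced Q H K) * p‖ ≤ ‖p‖ * ‖b - toReduced Q H K‖ * ‖p‖ := norm_mul₃_le
        _ ≤ 1 * ‖b - toReduced Q H K‖ * 1 := by gcongr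
        _ = _ := by ring
    have h2 : ‖(K x x - 1) • p‖ ≤ ‖K x x - 1‖ := by
      rw [norm_smul]
      exact mul_le_of_le_one_right (norm_nonneg _) hp1
    rw [e]
    linarith [norm_add_le (p * (b - toReduced Q H K) * p) ((K x x - 1) • p)]
  -- Inverting `1 + r` in the whole algebra avoids working in the corner: since `r * p = r`,
  -- multiplying `1 + r` by `p` gives `p * b * p`, so `p` is a multiple of an element of `I`.
  have hunit : IsUnit (1 + r) := by
    have := isUnit_one_sub_of_norm_lt_one (x := -r) (by rwa [norm_neg])
    rwa [sub_neg_eq_add] at this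
  obtain ⟨u, hu⟩ := hunit
  have hup : (u : reducedCStar Q H) * p = p * b * p := by
    rw [hu]
    simp only [r]
    rw [add_mul, sub_mul, one_mul, mul_assoc (p * b), hpp]
    abel
  have : p = ↑u⁻¹ * (p * b * p) := by rw [← hup, Units.inv_mul_cancel_left]
  rw [this]
  exact I.mul_mem_left _ _ (I.mul_mem_right _ _ (I.mul_mem_left _ _ hbI))

theorem isSimpleCStarAlgebra_reducedCStar {Z : Set (Subgroup Γ)} (hZ : IsURS Z)
    (hgen : IsGeneric Z) (hH : H ∈ Z) : IsSimpleCStarAlgebra (reducedCStar Q H) := by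
  classical
  refine ⟨⟨0, 1, fun h => ?_⟩, fun I _ => ?_⟩
  · have h' : toOp (0 : LocalKernelAlgebra Q H) = toOp (1 : LocalKernelAlgebra Q H) := by
      rw [toOp_zero, toOp_one]
      exact congrArg Subtype.val h
    have := congrArg (fun K : LocalKernelAlgebra Q H => K ((1 : Γ) : Γ ⧸ H) ((1 : Γ) : Γ ⧸ H))
      (toOp_injective h')
    simp [LocalKernelAlgebra.zero_apply, LocalKernelAlgebra.one_apply] at this
  · by_cases hI : I = ⊥
    · exact Or.inl hI
    · obtain ⟨P, x, hS, hp⟩ := exists_indicator_mem hZ hgen hH I hI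
      -- The covering argument is purely algebraic, so it runs in the local kernel algebra on the
      -- pulled-back ideal.
      have h1 := one_mem_of_indicator_mem hZ hH (I.comap (toReduced Q H)) P x hS
        ((TwoSidedIdeal.mem_comap _).2 hp)
      rw [TwoSidedIdeal.mem_comap, map_one] at h1
      exact Or.inr ((TwoSidedIdeal.one_mem_iff I).1 h1)

end Simplicity

end Elek

end

theorem corollary5p2 {Γ : Type*} [Group Γ] (Q : Elek.GeneratingSystem Γ)
    (Z : Set (Subgroup Γ)) (hZ : Elek.IsURS Z) (hgen : Elek.IsGeneric Z)
    (H : Subgroup Γ) (hH : H ∈ Z) :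
    Elek.IsSimpleCStarAlgebra (Elek.reducedCStar Q H) :=
  Elek.isSimpleCStarAlgebra_reducedCStar hZ hgen hH
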